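/- Let $S$ be a monoid, $G$ a non-trivial group, and let $\sigma\colon S\to\mathrm{End}(G)$, $s\mapsto\sigma_s$, be a faithful algebraic action, i.e. an injective monoid homomorphism such that every $\sigma_s$ is injective. Assume that $\sigma$ is non-automorphic, i.e. $\sigma_sG\subsetneq G$ for some $s\in S$. Let $I$ be the inverse semigroup of partial bijections of $G$ generated by all $\sigma_s$ ($s\in S$) and all translations $\tau_g\colon h\mapsto gh$ ($g\in G$), and let $I^e\subseteq I$ be the inverse subsemigroup generated by all $\sigma_s$. Let $\mathcal C$ be the smallest family of subgroups of $G$ with $G\in\mathcal C$ and with $\sigma_sC\in\mathcal C$, $\sigma_s^{-1}C\in\mathcal C$ whenever $C\in\mathcal C$, $s\in S$ (the constructible subgroups). Let $\mathcal E$ be the semilattice of idempotents of $I$, identified with a family of subsets of $G$ via $\mathrm{id}_X\leftrightarrow X$. Let $\widehat{\mathcal E}$ be the space of characters of $\mathcal E$, i.e. non-zero multiplicative maps $\chi\colon\mathcal E\to\{0,1\}$ with $\chi(\emptyset)=0$, with the topology of pointwise convergence. Let $\partial\widehat{\mathcal E}$ be the closure of the set of those $\chi$ for which $\{X\in\mathcal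 E:\chi(X)=1\}$ is maximal with respect to inclusion. For $\phi\in I$ and $\chi\in\widehat{\mathcal E}$ with $\chi(\mathrm{dom}\,\phi)=1$ put $(\phi.\chi)(X)=\chi(\phi^{-1}(X\cap\mathrm{im}\,\phi))$. Let $\mathcal G_\sigma=I\ltimes\partial\widehat{\mathcal E}$ be the groupoid with unit space $\partial\widehat{\mathcal E}$ whose arrows are the germs $[\phi,\chi]$ with $\chi(\mathrm{dom}\,\phi)=1$ and $\chi,\phi.\chi\in\partial\widehat{\mathcal E}$, where $[\phi,\chi]=[\psi,\chi]$ if and only if $\phi|_X=\psi|_X$ for some $X\in\mathcal E$ with $\chi(X)=1$; the source is $\chi$, the range is $\phi.\chi$, and $[\phi,\psi.\chi][\psi,\chi]=[\phi\psi,\chi]$, $[\phi,\chi]^{-1}=[\phi^{-1},\phi.\chi]$. It is called minimal if $\partial\widehat{\mathcal E}$ has no closed invariant subsets other than $\emptyset$ and $\partial\widehat{\mathcal E}$. A filter on $\mathcal C$ is a subset $\mathfrak F\subseteq\mathcal C$ that contains $G$, is closed under finite intersections, and contains every $D\in\mathcal C$ that contains some member of $\mathfrak F$. It is finitely hereditary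 if $C\in\mathfrak F$, $D\in\mathcal C$, $D\subseteq C$ and $[C:D]<\infty$ imply $D\in\mathfrak F$. Let $\mathfrak F_{\mathcal C}$ be the set of finitely hereditary filters on $\mathcal C$. For $\varphi\in I^e$ and $\mathfrak F\in\mathfrak F_{\mathcal C}$, $\varphi.\mathfrak F$ is defined if some $C\in\mathfrak F$ satisfies $C\subseteq\mathrm{dom}\,\varphi$, and then $\varphi.\mathfrak F$ is the smallest element of $\mathfrak F_{\mathcal C}$ that contains $\{\varphi(D):D\in\mathfrak F,\ D\subseteq\mathrm{dom}\,\varphi\}$. A subset $\mathbf F\subseteq\mathfrak F_{\mathcal C}$ is $I^e$-invariant if $\varphi.\mathfrak F\in\mathbf F$ whenever $\mathfrak F\in\mathbf F$, $\varphi\in I^e$ and $\varphi.\mathfrak F$ is defined. It is $\subseteq$-closed if every $\mathfrak H\in\mathfrak F_{\mathcal C}$ with $\mathfrak H\subseteq\bigcup_{\mathfrak F\in\mathbf F}\mathfrak F$ belongs to $\mathbf F$. Then each of the following conditions is equivalent to minimality of $\mathcal G_\sigma$: (M1) For all $C,D\in\mathcal C$ there exist $\phi_1,\dots,\phi_n\in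 I$ such that $C\subseteq\bigcup_{i=1}^n\phi_i(\mathrm{dom}(\phi_i)\cap D)$. (M2) For all $D\in\mathcal C$ there exist $\phi_1,\dots,\phi_n\in I$ such that $G=\bigcup_{i=1}^n\phi_i(\mathrm{dom}(\phi_i)\cap D)$. (M3) For all $C,D\in\mathcal C$ there exist $\varphi\in I^e$ and $D'\in\mathcal C$ with $D'\subseteq D\cap\mathrm{dom}(\varphi)$ such that $\varphi(D')\subseteq C$ and $[C:\varphi(D')]<\infty$. (M4) For all $D\in\mathcal C$ there exist $\varphi\in I^e$ and $D'\in\mathcal C$ with $D'\subseteq D\cap\mathrm{dom}(\varphi)$ such that $[G:\varphi(D')]<\infty$. (M5) $\mathfrak F_{\mathcal C}$ contains no non-empty, proper, $I^e$-invariant, $\subseteq$-closed subset. -/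

import Mathlib

/-! ### Partial bijections -/

namespace PartialBij

variable {G : Type*}

/-- The domain of a partial bijection. -/
def dom (f : G ≃. G) : Set G := {x | ∃ y, y ∈ f x}

/-- The image `f (X ∩ dom f)` of a set under a partial bijection. -/
def image (f : G ≃. G) (X : Set G) : Set G := {y | ∃ x ∈ X, y ∈ f x}

/-- The preimage `{x ∈ dom f | f x ∈ X}` of a set under a partial bijection. -/
def preimage (f : G ≃. G) (X : Set G) : Set G := {x | ∃ y ∈ X, y ∈ f x}

/-- The identity map of a subset, as a partial bijection. -/
noncomputable def idOn (X : Set G) : G ≃. G :=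
  @PEquiv.ofSet G X (fun _ => Classical.propDecidable _)

/-- An injective map `f : G → G`, viewed as the partial bijection from `G` onto its range. -/
noncomputable def ofInjective (f : G → G) (hf : Function.Injective f) : G ≃. G where
  toFun x := some (f x)
  invFun := Function.partialInv f
  inv a b := by
    have h := Function.Injective.isPartialInv hf a b
    constructor
    · intro hb; exact congrArg some (h.1 hb)
    · intro hb; exact h.2 (Option.some.inj hb)

/-- The inverse subsemigroup of the partial bijections of `G` generated by a set `A`.
`f.trans g` is the composition "first `f`, then `g`" on the largest possible domain. -/
inductive InverseClosure (A : Set (G ≃. G)) : (G ≃. G) → Prop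
  | basic {f : G ≃. G} (hf : f ∈ A) : InverseClosure A f
  | symm {f : G ≃. G} (hf : InverseClosure A f) : InverseClosure A f.symm
  | trans {f g : G ≃. G} (hf : InverseClosure A f) (hg : InverseClosure A g) :
      InverseClosure A (f.trans g)

theorem mem_idOn {X : Set G} {x y : G} : y ∈ idOn X x ↔ x ∈ X ∧ y = x := by
  refine Iff.trans (@PEquiv.mem_ofSet_iff G X (fun _ => Classical.propDecidable _) y x) ?_
  constructor
  · rintro ⟨rfl, h⟩; exact ⟨h, rfl⟩
  · rintro ⟨h, rfl⟩; exact ⟨rfl, h⟩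

theorem ext_mem {f g : G ≃. G} (h : ∀ x y, y ∈ f x ↔ y ∈ g x) : f = g :=
  PEquiv.ext fun x => Option.ext fun y => h x y

/-- The idempotent partial bijections are exactly the identity maps of subsets. -/
theorem trans_self_iff (f : G ≃. G) : f.trans f = f ↔ f = idOn (dom f) := by
  constructor
  · intro h
    refine ext_mem fun x y => ?_
    rw [mem_idOn]
    constructor
    · intro hy
      refine ⟨⟨y, hy⟩, ?_⟩
      have hy2 := hy
      rw [← h, PEquiv.mem_trans] at hy2
      obtain ⟨z, hz, hzy⟩ := hy2
      exact f.inj hzy hy ▸ Option.mem_unique hy hz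
    · rintro ⟨⟨z, hz⟩, rfl⟩
      have hz2 := hz
      rw [← h, PEquiv.mem_trans] at hz2
      obtain ⟨w, hw, hwz⟩ := hz2
      have := f.inj hwz hz
      subst this
      exact hw
  · intro h
    rw [h]
    refine ext_mem fun x y => ?_
    simp only [PEquiv.mem_trans, mem_idOn]
    constructor
    · rintro ⟨b, ⟨hb, rfl⟩, h2⟩; exact h2
    · rintro ⟨hx, rfl⟩; exact ⟨y, ⟨hx, rfl⟩, hx, rfl⟩

theorem preimage_refl (X : Set G) : preimage (PEquiv.refl G) X = X := by
  ext x; simp [preimage]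

theorem preimage_trans (f g : G ≃. G) (X : Set G) :
    preimage (f.trans g) X = preimage f (preimage g X) := by
  ext x
  simp only [preimage, Set.mem_ofPred_eq, PEquiv.mem_trans]
  constructor
  · rintro ⟨z, hz, y, h1, h2⟩; exact ⟨y, ⟨z, hz, h2⟩, h1⟩
  · rintro ⟨y, ⟨z, hz, h2⟩, h1⟩; exact ⟨z, hz, y, h1, h2⟩

theorem preimage_dom (f g : G ≃. G) : preimage f (dom g) = dom (f.trans g) := by
  ext x
  simp only [preimage, dom, Set.mem_ofPred_eq, PEquiv.mem_trans]
  constructor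
  · rintro ⟨y, ⟨z, h2⟩, h1⟩; exact ⟨z, y, h1, h2⟩
  · rintro ⟨z, y, h1, h2⟩; exact ⟨y, ⟨z, h2⟩, h1⟩

theorem image_idOn (X Y : Set G) : image (idOn X) Y = Y ∩ X := by
  ext y
  simp only [image, mem_idOn, Set.mem_ofPred_eq]
  constructor
  · rintro ⟨x, hx, hxX, rfl⟩; exact ⟨hx, hxX⟩
  · rintro ⟨h1, h2⟩; exact ⟨y, h1, h2, rfl⟩

theorem idOn_image (f : G ≃. G) (X : Set G) :
    idOn (image f X) = (f.symm.trans (idOn X)).trans f := by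
  refine ext_mem fun x y => ?_
  simp only [PEquiv.mem_trans, mem_idOn, PEquiv.mem_iff_mem]
  constructor
  · rintro ⟨⟨z, hz, hzx⟩, rfl⟩
    exact ⟨z, ⟨z, hzx, hz, rfl⟩, hzx⟩
  · rintro ⟨z, ⟨w, hw, hwX, rfl⟩, hz⟩
    obtain rfl := Option.mem_unique hw hz
    exact ⟨⟨z, hwX, hw⟩, rfl⟩

end PartialBij

/-! ### Minimal groupoids -/

/-- A groupoid with topologized unit space is minimal if its unit space has no closed invariant
subsets other than the empty set and the whole unit space. -/
def GroupoidIsMinimal (X : Type*) [TopologicalSpace X] [CategoryTheory.Groupoid X] : Prop :=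
  ∀ Y : Set X, IsClosed Y → (∀ x y : X, Nonempty (x ⟶ y) → x ∈ Y → y ∈ Y) →
    Y = ∅ ∨ Y = Set.univ

/-! ### Algebraic actions -/

/-- A (faithful) algebraic action of a monoid `S` on a group `G`: an injective homomorphism from
`S` to the monoid of endomorphisms of `G`, with values in the injective endomorphisms. -/
structure AlgebraicAction (S G : Type*) [Monoid S] [Group G] where
  toHom : S →* Monoid.End G
  injective : ∀ s, Function.Injective (toHom s)
  faithful : Function.Injective toHom

namespace AlgebraicAction

open PartialBij

variable {S G : Type*} [Monoid S] [Group G] (σ : AlgebraicAction S G)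

/-- The action is non-automorphic if some `σ_s` is not an automorphism, that is, not onto. -/
def NonAutomorphic : Prop := ∃ s, ¬ Function.Surjective (σ.toHom s)

/-- `σ_s` as a partial bijection of `G`. -/
noncomputable def endo (s : S) : G ≃. G := ofInjective (σ.toHom s) (σ.injective s)

/-- The translation `h ↦ g * h` as a partial bijection of `G`. -/
def translation (g : G) : G ≃. G := (Equiv.mulLeft g).toPEquiv

/-- The inverse semigroup `I` generated by the endomorphisms `σ_s` and the translations. -/
def I : Set (G ≃. G) :=
  {φ | InverseClosure (Set.range σ.endo ∪ Set.range translation) φ}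

/-- The inverse semigroup `I^e` generated by the endomorphisms `σ_s`. -/
def Ie : Set (G ≃. G) := {φ | InverseClosure (Set.range σ.endo) φ}

/-- The family `𝒞` of constructible subgroups: the smallest family of subgroups that contains `G`
and is closed under images and preimages under all `σ_s`. -/
inductive Constructible : Subgroup G → Prop
  | top : Constructible ⊤
  | map (s : S) {C : Subgroup G} (hC : Constructible C) : Constructible (C.map (σ.toHom s))
  | comap (s : S) {C : Subgroup G} (hC : Constructible C) : Constructible (C.comap (σ.toHom s))

/-- The semilattice `ℰ` of idempotents of `I`. The idempotents are the identity maps `id_X` that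
belong to `I`; we identify `id_X` with the subset `X` of `G`, and products with intersections. -/
def E : Set (Set G) := {X | idOn X ∈ σ.I}

variable {σ}

theorem refl_mem_I : PEquiv.refl G ∈ σ.I := by
  have : translation (1 : G) = PEquiv.refl G := by
    unfold translation; ext x y; simp
  rw [← this]
  exact .basic (Or.inr ⟨1, rfl⟩)

theorem univ_mem_E : Set.univ ∈ σ.E := by
  have : idOn (Set.univ : Set G) = PEquiv.refl G := by
    refine ext_mem fun x y => ?_
    rw [mem_idOn]
    simp [eq_comm]
  change idOn _ ∈ σ.I
  rw [this]
  exact refl_mem_I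

theorem inter_mem_E {X Y : Set G} (hX : X ∈ σ.E) (hY : Y ∈ σ.E) : X ∩ Y ∈ σ.E := by
  have : idOn (X ∩ Y) = (idOn X).trans (idOn Y) := by
    refine ext_mem fun x y => ?_
    simp only [PEquiv.mem_trans, mem_idOn]
    constructor
    · rintro ⟨⟨h1, h2⟩, rfl⟩; exact ⟨y, ⟨h1, rfl⟩, h2, rfl⟩
    · rintro ⟨b, ⟨h1, rfl⟩, h2, rfl⟩; exact ⟨⟨h1, h2⟩, rfl⟩
  change idOn _ ∈ σ.I
  rw [this]
  exact .trans hX hY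

theorem preimage_mem_E {φ : G ≃. G} (hφ : φ ∈ σ.I) {X : Set G} (hX : X ∈ σ.E) :
    preimage φ X ∈ σ.E := by
  have : idOn (preimage φ X) = (φ.trans (idOn X)).trans φ.symm := by
    refine ext_mem fun x y => ?_
    simp only [PEquiv.mem_trans, mem_idOn, PEquiv.mem_iff_mem]
    constructor
    · rintro ⟨⟨z, hz, hzx⟩, rfl⟩
      exact ⟨z, ⟨z, hzx, hz, rfl⟩, hzx⟩
    · rintro ⟨z, ⟨w, hw, hwX, rfl⟩, hz⟩
      exact ⟨⟨z, hwX, hw⟩, φ.inj hz hw⟩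
  change idOn _ ∈ σ.I
  rw [this]
  exact .trans (.trans hφ hX) (.symm hφ)

theorem dom_mem_E {φ : G ≃. G} (hφ : φ ∈ σ.I) : dom φ ∈ σ.E := by
  have : dom φ = preimage φ Set.univ := by
    ext x; simp [dom, preimage]
  rw [this]
  exact preimage_mem_E hφ univ_mem_E

variable (σ)

/-! ### Characters of the idempotent semilattice and the boundary -/

/-- The space of characters of `ℰ`: non-zero multiplicative maps from `ℰ` to `{0, 1}` that send
`∅` to `0`, with the topology of pointwise convergence. -/
def Character : Type _ :=
  {χ : σ.E → Bool //
    (∃ X, χ X = true) ∧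
    (∀ X Y : σ.E, χ ⟨X ∩ Y, inter_mem_E X.2 Y.2⟩ = (χ X && χ Y)) ∧
    (∀ h : ∅ ∈ σ.E, χ ⟨∅, h⟩ = false)}

instance : TopologicalSpace σ.Character :=
  TopologicalSpace.induced (fun χ : σ.Character => (χ.1 : σ.E → Bool)) inferInstance

/-- The filter `{X ∈ ℰ | χ X = 1}` of a character. -/
def Character.filter {σ : AlgebraicAction S G} (χ : σ.Character) : Set σ.E :=
  {X | χ.1 X = true}

/-- The characters whose filter is maximal with respect to inclusion. -/
def maxCharacters : Set σ.Character :=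
  {χ | ∀ χ' : σ.Character, χ.filter ⊆ χ'.filter → χ'.filter = χ.filter}

/-- The boundary `∂ℰ̂`: the closure of the set of maximal characters. -/
def boundary : Set σ.Character := closure σ.maxCharacters

variable {σ}

theorem Character.mono (χ : σ.Character) {X Y : σ.E} (h : (X : Set G) ⊆ Y)
    (hX : χ.1 X = true) : χ.1 Y = true := by
  have h1 := χ.2.2.1 X Y
  have h2 : (⟨X ∩ Y, inter_mem_E X.2 Y.2⟩ : σ.E) = X :=
    Subtype.ext (Set.inter_eq_left.2 h)
  rw [h2, hX] at h1
  simpa using h1.symm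

theorem Character.univ (χ : σ.Character) : χ.1 ⟨Set.univ, univ_mem_E⟩ = true := by
  obtain ⟨X, hX⟩ := χ.2.1
  exact χ.mono (Set.subset_univ _) hX

/-- For a character `χ` with `χ (dom φ) = 1`, the character `φ.χ` given by
`(φ.χ) X = χ (φ⁻¹ X φ)`; the idempotent `φ⁻¹ X φ` is the preimage of `X` under `φ`. -/
def Character.act (φ : G ≃. G) (hφ : φ ∈ σ.I) (χ : σ.Character)
    (h : χ.1 ⟨dom φ, dom_mem_E hφ⟩ = true) : σ.Character :=
  ⟨fun X => χ.1 ⟨preimage φ X, preimage_mem_E hφ X.2⟩, by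
    refine ⟨⟨⟨Set.univ, univ_mem_E⟩, ?_⟩, ?_, ?_⟩
    · refine χ.mono ?_ h
      rintro x ⟨y, hy⟩
      exact ⟨y, trivial, hy⟩
    · intro X Y
      refine Eq.trans (congrArg χ.1 (Subtype.ext ?_))
        (χ.2.2.1 ⟨preimage φ X, preimage_mem_E hφ X.2⟩ ⟨preimage φ Y, preimage_mem_E hφ Y.2⟩)
      ext x
      constructor
      · rintro ⟨y, ⟨h1, h2⟩, hy⟩
        exact ⟨⟨y, h1, hy⟩, y, h2, hy⟩
      · rintro ⟨⟨y, h1, hy⟩, z, h2, hz⟩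
        obtain rfl := Option.mem_unique hy hz
        exact ⟨y, ⟨h1, h2⟩, hy⟩
    · intro h0
      have : preimage φ ∅ = (∅ : Set G) := by ext x; simp [preimage]
      exact (congrArg χ.1 (Subtype.ext this)).trans (χ.2.2.2 h0)⟩

/-! ### The groupoid of germs -/

/-- The elements `φ` of `I` for which `φ.χ` is defined and equal to `ω`. -/
structure PreGerm (χ ω : σ.Character) where
  φ : G ≃. G
  mem : φ ∈ σ.I
  dom_mem : χ.1 ⟨dom φ, dom_mem_E mem⟩ = true
  act_eq : χ.act φ mem dom_mem = ω

/-- `φ` and `ψ` have the same germ at `χ` if they have the same restriction to some `X ∈ ℰ` with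
`χ X = 1` (such an `X` is non-empty, since characters vanish at `∅`). -/
instance germSetoid (χ ω : σ.Character) : Setoid (PreGerm χ ω) where
  r a b := ∃ X : σ.E, χ.1 X = true ∧ ∀ x ∈ (X : Set G), a.φ x = b.φ x
  iseqv :=
    { refl := fun _ => ⟨_, χ.univ, fun _ _ => rfl⟩
      symm := fun ⟨X, hX, h⟩ => ⟨X, hX, fun x hx => (h x hx).symm⟩
      trans := fun ⟨X, hX, h⟩ ⟨Y, hY, k⟩ =>
        ⟨⟨X ∩ Y, inter_mem_E X.2 Y.2⟩, by rw [χ.2.2.1, hX, hY]; rfl,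
          fun x hx => (h x hx.1).trans (k x hx.2)⟩ }

/-- The germs `[φ, χ]` with source `χ` and range `φ.χ = ω`. -/
def Germ (χ ω : σ.Character) : Type _ := Quotient (germSetoid χ ω)

theorem PreGerm.apply {χ ω : σ.Character} (a : PreGerm χ ω) (X : σ.E) :
    ω.1 X = χ.1 ⟨preimage a.φ X, preimage_mem_E a.mem X.2⟩ := by
  conv_lhs => rw [← a.act_eq]
  rfl

/-- The unit `[id, χ]`. -/
def PreGerm.id (χ : σ.Character) : PreGerm χ χ where
  φ := PEquiv.refl G
  mem := refl_mem_I
  dom_mem := χ.mono (X := ⟨Set.univ, univ_mem_E⟩) (fun x _ => ⟨x, rfl⟩) χ.univ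
  act_eq := by
    apply Subtype.ext
    funext X
    exact congrArg χ.1 (Subtype.ext (preimage_refl _))

/-- The product `[ψ, φ.χ] [φ, χ] = [ψ φ, χ]`. -/
def PreGerm.comp {χ ω η : σ.Character} (a : PreGerm χ ω) (b : PreGerm ω η) : PreGerm χ η where
  φ := a.φ.trans b.φ
  mem := .trans a.mem b.mem
  dom_mem := by
    have h := b.dom_mem
    rw [a.apply] at h
    exact (congrArg χ.1 (Subtype.ext (preimage_dom _ _).symm)).trans h
  act_eq := by
    apply Subtype.ext
    funext X
    refine Eq.trans ?_ (b.apply X).symm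
    refine Eq.trans ?_ (a.apply _).symm
    exact congrArg χ.1 (Subtype.ext (preimage_trans _ _ _))

/-- The inverse `[φ, χ]⁻¹ = [φ⁻¹, φ.χ]`. -/
def PreGerm.inv {χ ω : σ.Character} (a : PreGerm χ ω) : PreGerm ω χ :=
  have hd : ω.1 ⟨dom a.φ.symm, dom_mem_E (.symm a.mem)⟩ = true := by
    rw [a.apply]
    refine χ.mono ?_ a.dom_mem
    rintro x ⟨y, hy⟩
    exact ⟨y, ⟨x, a.φ.mem_iff_mem.2 hy⟩, hy⟩
  { φ := a.φ.symm
    mem := .symm a.mem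
    dom_mem := hd
    act_eq := by
      apply Subtype.ext
      funext X
      change ω.1 ⟨preimage a.φ.symm X, _⟩ = _
      rw [a.apply]
      have h1 := χ.2.2.1 ⟨dom a.φ, dom_mem_E a.mem⟩ X
      rw [a.dom_mem, Bool.true_and] at h1
      rw [← h1]
      refine congrArg χ.1 (Subtype.ext ?_)
      ext x
      constructor
      · rintro ⟨y, ⟨z, hz, hzy⟩, hy⟩
        obtain rfl := a.φ.inj hy (a.φ.mem_iff_mem.1 hzy)
        exact ⟨⟨y, hy⟩, hz⟩
      · rintro ⟨⟨y, hy⟩, hx⟩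
        exact ⟨y, ⟨x, hx, a.φ.mem_iff_mem.2 hy⟩, hy⟩ }

/-- The transformation groupoid `I ⋉ ℰ̂`: units are the characters of `ℰ`, and the arrows from `χ`
to `ω` are the germs `[φ, χ]` with `φ.χ = ω`. -/
instance characterGroupoid : CategoryTheory.Groupoid σ.Character where
  Hom χ ω := Germ χ ω
  id χ := Quotient.mk _ (PreGerm.id χ)
  comp {χ ω η} := Quotient.map₂ PreGerm.comp (by
    rintro a a' ⟨X, hX, h⟩ b b' ⟨Y, hY, k⟩
    rw [a.apply] at hY
    refine ⟨⟨X ∩ preimage a.φ Y, inter_mem_E X.2 (preimage_mem_E a.mem Y.2)⟩, ?_, ?_⟩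
    · rw [χ.2.2.1 X ⟨preimage a.φ Y, preimage_mem_E a.mem Y.2⟩, hX, hY]; rfl
    · rintro x ⟨hx, y, hy, hxy⟩
      have h1 : a.φ x = some y := hxy
      have h2 : a'.φ x = some y := (h x hx).symm.trans h1
      change (a.φ x).bind b.φ = (a'.φ x).bind b'.φ
      rw [h1, h2]
      exact k y hy)
  id_comp := by
    rintro χ ω ⟨a⟩
    exact Quotient.sound ⟨_, χ.univ, fun _ _ => rfl⟩
  comp_id := by
    rintro χ ω ⟨a⟩
    refine Quotient.sound ⟨_, χ.univ, fun x _ => ?_⟩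
    exact congrArg (fun f : G ≃. G => f x) (PEquiv.trans_refl a.φ)
  assoc := by
    rintro χ ω η θ ⟨a⟩ ⟨b⟩ ⟨c⟩
    refine Quotient.sound ⟨_, χ.univ, fun x _ => ?_⟩
    exact congrArg (fun f : G ≃. G => f x) (PEquiv.trans_assoc a.φ b.φ c.φ)
  inv {χ ω} := Quotient.map PreGerm.inv (by
    rintro a b ⟨X, hX, h⟩
    refine ⟨⟨preimage a.φ.symm X, preimage_mem_E (.symm a.mem) X.2⟩, ?_, ?_⟩
    · have h1 := congrArg (fun χ' : σ.Character => χ'.1 X) a.inv.act_eq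
      exact h1.trans hX
    · rintro y ⟨x, hx, hxy⟩
      have h1 : a.φ.symm y = some x := hxy
      have h2 : b.φ x = some y := (h x hx).symm.trans (a.φ.eq_some_iff.1 h1)
      change a.φ.symm y = b.φ.symm y
      rw [h1, b.φ.eq_some_iff.2 h2])
  inv_comp := by
    rintro χ ω ⟨a⟩
    refine Quotient.sound ⟨⟨dom a.φ.symm, dom_mem_E (.symm a.mem)⟩, a.inv.dom_mem, ?_⟩
    rintro y ⟨x, hx⟩
    have h1 : a.φ.symm y = some x := hx
    change (a.φ.symm y).bind a.φ = some y
    rw [h1]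
    exact a.φ.eq_some_iff.1 h1
  comp_inv := by
    rintro χ ω ⟨a⟩
    refine Quotient.sound ⟨⟨dom a.φ, dom_mem_E a.mem⟩, a.dom_mem, ?_⟩
    rintro x ⟨y, hy⟩
    have h1 : a.φ x = some y := hy
    change (a.φ x).bind a.φ.symm = some x
    rw [h1]
    exact a.φ.eq_some_iff.2 h1

variable (σ)

/-- The unit space `∂ℰ̂` of the groupoid `𝒢_σ`, with the subspace topology. -/
abbrev UnitSpace : Type _ := {χ : σ.Character // χ ∈ σ.boundary}

/-- The groupoid `𝒢_σ`: the restriction of `I ⋉ ℰ̂` to the boundary, that is, all germs `[φ, χ]`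
for which both `χ` and `φ.χ` lie in the boundary. -/
instance groupoid : CategoryTheory.Groupoid σ.UnitSpace where
  Hom χ ω := Germ χ.1 ω.1
  id χ := characterGroupoid.id χ.1
  comp f g := characterGroupoid.comp f g
  id_comp f := characterGroupoid.id_comp f
  comp_id f := characterGroupoid.comp_id f
  assoc f g h := characterGroupoid.assoc f g h
  inv f := characterGroupoid.inv f
  inv_comp f := characterGroupoid.inv_comp f
  comp_inv f := characterGroupoid.comp_inv f

/-! ### Images of subgroups under `I^e` -/

variable {σ}

theorem Ie_subset_I : σ.Ie ⊆ σ.I := by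
  intro φ hφ
  induction hφ with
  | basic h => exact .basic (Or.inl h)
  | symm _ ih => exact .symm ih
  | trans _ _ ih1 ih2 => exact .trans ih1 ih2

theorem mem_endo {s : S} {x y : G} : y ∈ σ.endo s x ↔ σ.toHom s x = y := by
  change (some (σ.toHom s x) = some y) ↔ _
  exact Option.some_inj

theorem Ie_one {φ : G ≃. G} (hφ : φ ∈ σ.Ie) : (1 : G) ∈ φ 1 := by
  induction hφ with
  | basic h =>
    obtain ⟨s, rfl⟩ := h
    exact mem_endo.2 (map_one _)
  | symm _ ih => exact (PEquiv.mem_iff_mem _).2 ih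
  | trans _ _ ih1 ih2 => exact (PEquiv.mem_trans _ _ _ _).2 ⟨1, ih1, ih2⟩

theorem Ie_mul {φ : G ≃. G} (hφ : φ ∈ σ.Ie) :
    ∀ {x y x' y' : G}, y ∈ φ x → y' ∈ φ x' → y * y' ∈ φ (x * x') := by
  induction hφ with
  | basic h =>
    obtain ⟨s, rfl⟩ := h
    intro x y x' y' h1 h2
    rw [mem_endo] at *
    rw [map_mul, h1, h2]
  | symm _ ih =>
    intro x y x' y' h1 h2
    rw [PEquiv.mem_iff_mem] at *
    exact ih h1 h2
  | trans _ _ ih1 ih2 =>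
    intro x y x' y' h1 h2
    rw [PEquiv.mem_trans] at *
    obtain ⟨b, hb, hb2⟩ := h1
    obtain ⟨c, hc, hc2⟩ := h2
    exact ⟨b * c, ih1 hb hc, ih2 hb2 hc2⟩

theorem Ie_inv {φ : G ≃. G} (hφ : φ ∈ σ.Ie) :
    ∀ {x y : G}, y ∈ φ x → y⁻¹ ∈ φ x⁻¹ := by
  induction hφ with
  | basic h =>
    obtain ⟨s, rfl⟩ := h
    intro x y h1
    rw [mem_endo] at *
    rw [map_inv, h1]
  | symm _ ih =>
    intro x y h1
    rw [PEquiv.mem_iff_mem] at *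
    exact ih h1
  | trans _ _ ih1 ih2 =>
    intro x y h1
    rw [PEquiv.mem_trans] at *
    obtain ⟨b, hb, hb2⟩ := h1
    exact ⟨b⁻¹, ih1 hb, ih2 hb2⟩

/-- For `φ ∈ I^e`, the subgroup `φ (D ∩ dom φ)`; it is `φ (D)` if `D` is contained in `dom φ`. -/
def imageSubgroup (φ : G ≃. G) (hφ : φ ∈ σ.Ie) (D : Subgroup G) : Subgroup G where
  carrier := image φ D
  one_mem' := ⟨1, D.one_mem, Ie_one hφ⟩
  mul_mem' := by
    rintro _ _ ⟨x, hx, h1⟩ ⟨x', hx', h2⟩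
    exact ⟨x * x', D.mul_mem hx hx', Ie_mul hφ h1 h2⟩
  inv_mem' := by
    rintro _ ⟨x, hx, h1⟩
    exact ⟨x⁻¹, D.inv_mem hx, Ie_inv hφ h1⟩

theorem constructible_image_aux {φ : G ≃. G} (hφ : φ ∈ σ.Ie) :
    (∀ D, σ.Constructible D → ∃ K, σ.Constructible K ∧ (K : Set G) = image φ D) ∧
    (∀ D, σ.Constructible D → ∃ K, σ.Constructible K ∧ (K : Set G) = image φ.symm D) := by
  induction hφ with
  | basic h =>
    obtain ⟨s, rfl⟩ := h
    refine ⟨fun D hD => ⟨_, hD.map s, ?_⟩, fun D hD => ⟨_, hD.comap s, ?_⟩⟩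
    · ext y
      simp only [image, mem_endo, Set.mem_ofPred_eq]
      rfl
    · ext y
      simp only [image, PEquiv.mem_iff_mem, mem_endo, Set.mem_ofPred_eq]
      constructor
      · intro hy; exact ⟨σ.toHom s y, hy, rfl⟩
      · rintro ⟨x, hx, rfl⟩; exact hx
  | symm _ ih => exact ⟨ih.2, ih.1⟩
  | @trans f g _ _ ih1 ih2 =>
    have key : ∀ (f g : G ≃. G) (X : Set G), image (f.trans g) X = image g (image f X) := by
      intro f g X
      ext y
      simp only [image, Set.mem_ofPred_eq, PEquiv.mem_trans]
      constructor
      · rintro ⟨x, hx, b, h1, h2⟩; exact ⟨b, ⟨x, hx, h1⟩, h2⟩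
      · rintro ⟨b, ⟨x, hx, h1⟩, h2⟩; exact ⟨x, hx, b, h1, h2⟩
    constructor
    · intro D hD
      obtain ⟨K, hK, h1⟩ := ih1.1 D hD
      obtain ⟨L, hL, h2⟩ := ih2.1 K hK
      exact ⟨L, hL, by rw [h2, h1, key]⟩
    · intro D hD
      obtain ⟨K, hK, h1⟩ := ih2.2 D hD
      obtain ⟨L, hL, h2⟩ := ih1.2 K hK
      exact ⟨L, hL, by rw [PEquiv.symm_trans_rev, h2, h1, key]⟩

theorem constructible_image {φ : G ≃. G} (hφ : φ ∈ σ.Ie) {D : Subgroup G}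
    (hD : σ.Constructible D) : σ.Constructible (imageSubgroup φ hφ D) := by
  obtain ⟨K, hK, h⟩ := (constructible_image_aux hφ).1 D hD
  have : K = imageSubgroup φ hφ D := SetLike.coe_injective h
  exact this ▸ hK

theorem idOn_mem_Ie {C : Subgroup G} (hC : σ.Constructible C) : idOn (C : Set G) ∈ σ.Ie := by
  have hb : ∀ s, σ.endo s ∈ σ.Ie := fun s => .basic ⟨s, rfl⟩
  induction hC with
  | top =>
    have : idOn ((⊤ : Subgroup G) : Set G) = (σ.endo 1).trans (σ.endo 1).symm := by
      refine ext_mem fun x y => ?_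
      simp [-Option.mem_def, PEquiv.mem_trans, mem_idOn, PEquiv.mem_iff_mem, mem_endo]
    rw [this]
    exact .trans (hb 1) (.symm (hb 1))
  | @map s C _ ih =>
    have : ((C.map (σ.toHom s) : Subgroup G) : Set G) = image (σ.endo s) C := by
      ext y
      simp only [image, mem_endo, Set.mem_ofPred_eq]
      rfl
    rw [this, idOn_image]
    exact .trans (.trans (.symm (hb s)) ih) (hb s)
  | @comap s C _ ih =>
    have : ((C.comap (σ.toHom s) : Subgroup G) : Set G) = image (σ.endo s).symm C := by
      ext y
      simp only [image, PEquiv.mem_iff_mem, mem_endo, Set.mem_ofPred_eq]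
      constructor
      · intro hy; exact ⟨σ.toHom s y, hy, rfl⟩
      · rintro ⟨x, hx, rfl⟩; exact hx
    rw [this, idOn_image]
    exact .trans (.trans (.symm (.symm (hb s))) ih) (.symm (hb s))

theorem constructible_inf {C D : Subgroup G} (hC : σ.Constructible C) (hD : σ.Constructible D) :
    σ.Constructible (C ⊓ D) := by
  have h := constructible_image (idOn_mem_Ie hD) hC
  have : imageSubgroup (idOn (D : Set G)) (idOn_mem_Ie hD) C = C ⊓ D :=
    SetLike.coe_injective (image_idOn _ _)
  exact this ▸ h

/-! ### Finitely hereditary filters -/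

variable (σ)

/-- The set `𝔉_𝒞` of finitely hereditary filters on the family `𝒞` of constructible subgroups. -/
def FHFilters : Set (Set (Subgroup G)) :=
  {F | (∀ C ∈ F, σ.Constructible C) ∧
    ⊤ ∈ F ∧
    (∀ C D, C ∈ F → σ.Constructible D → C ≤ D → D ∈ F) ∧
    (∀ C D, C ∈ F → D ∈ F → C ⊓ D ∈ F) ∧
    (∀ C D, C ∈ F → σ.Constructible D → D ≤ C → D.IsFiniteRelIndex C → D ∈ F)}

variable {σ}

/-- `φ.F` is defined if some member of `F` is contained in `dom φ`. -/
def ActDefined (φ : G ≃. G) (F : Set (Subgroup G)) : Prop :=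
  ∃ C ∈ F, (C : Set G) ⊆ dom φ

/-- `φ.F`: the smallest finitely hereditary filter that contains all `φ (D)` with `D ∈ F` and
`D ⊆ dom φ`. -/
def act (φ : G ≃. G) (hφ : φ ∈ σ.Ie) (F : Set (Subgroup G)) : Set (Subgroup G) :=
  ⋂₀ {H | H ∈ σ.FHFilters ∧ ∀ D ∈ F, (D : Set G) ⊆ dom φ → imageSubgroup φ hφ D ∈ H}

theorem constructible_mem_FHFilters : {C | σ.Constructible C} ∈ σ.FHFilters := by
  refine ⟨fun _ h => h, .top, fun _ _ _ h _ => h, fun C D hC hD => ?_, fun _ _ _ h _ _ => h⟩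
  exact constructible_inf hC hD

/-- `φ.F` is a finitely hereditary filter and the least one with the stated property; moreover,
it suffices to use the sets `φ (C ∩ D)`, `D ∈ F`, for a single `C ∈ F` with `C ⊆ dom φ`. -/
theorem act_isLeast (φ : G ≃. G) (hφ : φ ∈ σ.Ie) {F : Set (Subgroup G)} (hF : F ∈ σ.FHFilters)
    {C : Subgroup G} (hC : C ∈ F) (hCφ : (C : Set G) ⊆ dom φ) :
    IsLeast {H | H ∈ σ.FHFilters ∧ ∀ D ∈ F, imageSubgroup φ hφ (C ⊓ D) ∈ H} (act φ hφ F) := by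
  have mono : ∀ A B : Subgroup G, A ≤ B → imageSubgroup φ hφ A ≤ imageSubgroup φ hφ B := by
    rintro A B h y ⟨x, hx, hy⟩
    exact ⟨x, h hx, hy⟩
  have hne := constructible_mem_FHFilters (σ := σ)
  refine ⟨⟨⟨?_, ?_, ?_, ?_, ?_⟩, ?_⟩, ?_⟩
  · intro A hA
    exact hA _ ⟨hne, fun D hD _ => constructible_image hφ (hF.1 D hD)⟩
  · rintro H ⟨hH, -⟩
    exact hH.2.1
  · rintro A B hA hB hAB H hH
    exact hH.1.2.2.1 A B (hA H hH) hB hAB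
  · rintro A B hA hB H hH
    exact hH.1.2.2.2.1 A B (hA H hH) (hB H hH)
  · rintro A B hA hB hBA hfin H hH
    exact hH.1.2.2.2.2 A B (hA H hH) hB hBA hfin
  · rintro D hD H hH
    exact hH.2 _ (hF.2.2.2.1 C D hC hD) (fun x hx => hCφ hx.1)
  · rintro H ⟨hH, h⟩ A hA
    refine hA H ⟨hH, fun D hD _ => ?_⟩
    exact hH.2.2.1 _ _ (h D hD) (constructible_image hφ (hF.1 D hD)) (mono _ _ inf_le_right)

variable (σ)

/-- A set of filters is `I^e`-invariant if it contains `φ.F` whenever it contains `F` and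
`φ ∈ I^e` is such that `φ.F` is defined. -/
def FilterInvariant (𝔉 : Set (Set (Subgroup G))) : Prop :=
  ∀ F ∈ 𝔉, ∀ (φ : G ≃. G) (hφ : φ ∈ σ.Ie), ActDefined φ F → act φ hφ F ∈ 𝔉

/-- A set `𝔉` of filters is `⊆`-closed if it contains every finitely hereditary filter that is
contained in the union of the members of `𝔉`. -/
def SubsetClosed (𝔉 : Set (Set (Subgroup G))) : Prop :=
  ∀ F ∈ σ.FHFilters, F ⊆ ⋃₀ 𝔉 → F ∈ 𝔉

end AlgebraicAction

namespace PartialBij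

variable {G : Type*}

/-! Up to translations, `I` is no larger than `I^e`: an element of `I` sending `x` to `y` is `τ_y ψ
τ_x⁻¹` with `ψ ∈ I^e` (`exists_mem_Ie_of_mem_I`). Hence the non-empty members of `ℰ` are exactly the
left cosets of constructible subgroups. Two cosets of one subgroup are equal or disjoint, so the
character of all idempotents through a point of `G` is maximal. Every maximal character is in turn a
limit of point characters, so the boundary is the closure of the copy of `G` formed by them. It is
compact, because `G ∈ ℰ` prevents a limit from being zero.

With this, minimality becomes (M2). The boundary characters vanishing on all `φ⁻¹(D)` form a proper
closed invariant set; if it is empty, compactness yields finitely many `φ⁻¹(D)` that cover `G`.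
Conversely, basic neighbourhoods of a point character are given by cosets `pC`, and a finite cover
of `G` by images of `C` lets every boundary character be moved into such a neighbourhood.

(M2) is equivalent to (M4) by B. H. Neumann's lemma: if finitely many cosets cover a group, one of
the subgroups involved has finite index. Intersecting with `C` turns (M4) into (M3), and (M1) is
(M2) with a superfluous `C`.

For (M5), `φ.F` is generated by the images `φ(D)` as an ordinary filter (`mem_act_iff`). Under (M4),
moving any one filter by `I^e` reaches every constructible subgroup. Conversely, the filters whose
members all contain an image `φ(B)` with `B` of finite index form an invariant `⊆`-closed set; if it
is everything, it contains `𝒞` itself, and this is (M4). -/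

theorem image_eq_preimage_symm (f : G ≃. G) (X : Set G) : image f X = preimage f.symm X := by
  ext y
  constructor
  · rintro ⟨x, hx, h⟩; exact ⟨x, hx, (f.mem_iff_mem).2 h⟩
  · rintro ⟨x, hx, h⟩; exact ⟨x, hx, (f.mem_iff_mem).1 h⟩

end PartialBij

namespace AlgebraicAction

open PartialBij

variable {S G : Type*} [Monoid S] [Group G] {σ : AlgebraicAction S G}

/-! ### Elements of `I` up to translation, and the idempotents as cosets -/

theorem mem_translation {g x y : G} : y ∈ translation g x ↔ y = g * x := by
  change (some (g * x) = some y) ↔ _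
  rw [Option.some_inj, eq_comm]

theorem translation_mem_I (g : G) : translation g ∈ σ.I := .basic (Or.inr ⟨g, rfl⟩)

theorem refl_mem_Ie : PEquiv.refl G ∈ σ.Ie := by
  have h : PEquiv.refl G = σ.endo 1 := by
    refine ext_mem fun x y => ?_
    rw [mem_endo, map_one]
    exact Option.some_inj
  rw [h]
  exact .basic ⟨1, rfl⟩

/-- Up to translations, every element of `I` that is defined somewhere belongs to `I^e`. -/
theorem exists_mem_Ie_of_mem_I {φ : G ≃. G} (hφ : φ ∈ σ.I) :
    ∀ {x y : G}, y ∈ φ x → ∃ ψ ∈ σ.Ie, ∀ a b, b ∈ φ a ↔ y⁻¹ * b ∈ ψ (x⁻¹ * a) := by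
  induction hφ with
  | basic h =>
    rcases h with ⟨s, rfl⟩ | ⟨g, rfl⟩
    · intro x y hxy
      refine ⟨σ.endo s, .basic ⟨s, rfl⟩, fun a b => ?_⟩
      rw [mem_endo] at *
      rw [mem_endo, map_mul, map_inv, hxy, mul_right_inj]
    · intro x y hxy
      refine ⟨PEquiv.refl G, refl_mem_Ie, fun a b => ?_⟩
      rw [mem_translation] at *
      refine Iff.trans ?_ Option.some_inj.symm
      subst hxy
      rw [mul_inv_rev, mul_assoc, mul_right_inj, eq_inv_mul_iff_mul_eq, eq_comm]
  | symm _ ih =>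
    intro x y hxy
    rw [PEquiv.mem_iff_mem] at hxy
    obtain ⟨ψ, hψ, h⟩ := ih hxy
    refine ⟨ψ.symm, .symm hψ, fun a b => ?_⟩
    rw [PEquiv.mem_iff_mem, PEquiv.mem_iff_mem]
    exact h b a
  | trans _ _ ih1 ih2 =>
    intro x z hxz
    rw [PEquiv.mem_trans] at hxz
    obtain ⟨y, h1, h2⟩ := hxz
    obtain ⟨ψ1, hψ1, k1⟩ := ih1 h1
    obtain ⟨ψ2, hψ2, k2⟩ := ih2 h2
    refine ⟨ψ1.trans ψ2, .trans hψ1 hψ2, fun a b => ?_⟩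
    rw [PEquiv.mem_trans, PEquiv.mem_trans]
    constructor
    · rintro ⟨c, hc1, hc2⟩
      exact ⟨y⁻¹ * c, (k1 a c).1 hc1, (k2 c b).1 hc2⟩
    · rintro ⟨c, hc1, hc2⟩
      refine ⟨y * c, (k1 _ _).2 ?_, (k2 _ _).2 ?_⟩ <;> rwa [inv_mul_cancel_left]

theorem Constructible.mem_E {C : Subgroup G} (hC : σ.Constructible C) : (C : Set G) ∈ σ.E :=
  Ie_subset_I (idOn_mem_Ie hC)

/-- The left coset `p C` of a constructible subgroup is an idempotent. -/
theorem coset_mem_E (p : G) {C : Subgroup G} (hC : σ.Constructible C) :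
    {x | p⁻¹ * x ∈ C} ∈ σ.E := by
  have h : {x | p⁻¹ * x ∈ C} = preimage (translation p⁻¹) (C : Set G) := by
    ext x
    simp only [preimage, mem_translation, Set.mem_ofPred_eq]
    exact ⟨fun hx => ⟨_, hx, rfl⟩, by rintro ⟨_, hx, rfl⟩; exact hx⟩
  rw [h]
  exact preimage_mem_E (translation_mem_I _) hC.mem_E

/-- A non-empty idempotent is a left coset of a constructible subgroup. -/
theorem exists_coset_of_mem_E {X : Set G} (hX : X ∈ σ.E) {p : G} (hp : p ∈ X) :
    ∃ C : Subgroup G, σ.Constructible C ∧ ∀ x, x ∈ X ↔ p⁻¹ * x ∈ C := by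
  obtain ⟨ψ, hψ, h⟩ := exists_mem_Ie_of_mem_I hX (mem_idOn.2 ⟨hp, rfl⟩)
  -- The subgroup is the domain of `ψ`, written as the image of `ψ.symm`.
  refine ⟨imageSubgroup ψ.symm (.symm hψ) ⊤, constructible_image _ .top, fun x => ?_⟩
  constructor
  · intro hx
    exact ⟨_, trivial, (PEquiv.mem_iff_mem _).2 ((h x x).1 (mem_idOn.2 ⟨hx, rfl⟩))⟩
  · rintro ⟨z, -, hz⟩
    rw [PEquiv.mem_iff_mem] at hz
    have := (h x (p * z)).2 (by rwa [inv_mul_cancel_left])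
    exact (mem_idOn.1 this).1

/-! ### Point characters and the boundary -/

open Classical in
/-- The character of all idempotents that contain a given point. -/
noncomputable def pointCharacter (σ : AlgebraicAction S G) (p : G) : σ.Character :=
  ⟨fun X => decide (p ∈ (X : Set G)), ⟨⟨_, univ_mem_E⟩, by simp⟩, fun X Y => by simp,
    fun h => by simp⟩

theorem pointCharacter_eq_true {p : G} {X : σ.E} :
    (σ.pointCharacter p).1 X = true ↔ p ∈ (X : Set G) := by
  simp [pointCharacter]

theorem Character.inter_eq_true (χ : σ.Character) {X Y : σ.E} (hX : χ.1 X = true)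
    (hY : χ.1 Y = true) : χ.1 ⟨X ∩ Y, inter_mem_E X.2 Y.2⟩ = true := by
  rw [χ.2.2.1, hX, hY]; rfl

theorem Character.nonempty (χ : σ.Character) {X : σ.E} (hX : χ.1 X = true) :
    (X : Set G).Nonempty := by
  rw [Set.nonempty_iff_ne_empty]
  obtain ⟨X, hXE⟩ := X
  rintro rfl
  rw [χ.2.2.2] at hX
  cases hX

/-- If a larger filter contains a coset `Z = zC`, it also contains `pC`. The two must meet, hence
coincide, so `p ∈ Z`. -/
theorem pointCharacter_mem_maxCharacters (p : G) : σ.pointCharacter p ∈ σ.maxCharacters := by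
  intro χ hχ
  refine Set.Subset.antisymm (fun Z hZ => ?_) hχ
  refine pointCharacter_eq_true.2 ?_
  by_contra hp
  obtain ⟨z, hz⟩ := χ.nonempty hZ
  obtain ⟨C, hC, h⟩ := exists_coset_of_mem_E Z.2 hz
  have hX : χ.1 ⟨_, coset_mem_E p hC⟩ = true :=
    hχ (a := ⟨_, coset_mem_E p hC⟩) (pointCharacter_eq_true.2 (by simp [C.one_mem]))
  obtain ⟨x, hx, hxZ⟩ := χ.nonempty (χ.inter_eq_true hX hZ)
  refine hp ((h p).2 ?_)
  have := C.mul_mem ((h x).1 hxZ) (C.inv_mem hx)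
  simpa [mul_assoc] using this

open Classical in
/-- If a maximal character vanishes at `Z`, then it is `1` at an idempotent disjoint from `Z`. -/
theorem exists_disjoint_of_mem_maxCharacters {χ : σ.Character} (hχ : χ ∈ σ.maxCharacters)
    {Z : σ.E} (hZ : χ.1 Z ≠ true) : ∃ X : σ.E, χ.1 X = true ∧ (X : Set G) ∩ Z = ∅ := by
  by_contra! hne
  -- The filter generated by that of `χ` together with `Z`; it is proper because `Z` meets every
  -- member. Maximality then forces `χ Z = 1`.
  let ω : σ.Character :=
    ⟨fun Y => decide (∃ X : σ.E, χ.1 X = true ∧ (X : Set G) ∩ Z ⊆ Y),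
      ⟨⟨_, univ_mem_E⟩, decide_eq_true ⟨_, χ.univ, Set.subset_univ _⟩⟩, fun X Y => by
        rw [← Bool.decide_and, decide_eq_decide]
        constructor
        · rintro ⟨W, hW, h⟩
          exact ⟨⟨W, hW, h.trans Set.inter_subset_left⟩, W, hW, h.trans Set.inter_subset_right⟩
        · rintro ⟨⟨W, hW, h⟩, W', hW', h'⟩
          exact ⟨_, χ.inter_eq_true hW hW', fun x hx => ⟨h ⟨hx.1.1, hx.2⟩, h' ⟨hx.1.2, hx.2⟩⟩⟩,
      fun _ => decide_eq_false (by
        rintro ⟨X, hX, h⟩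
        obtain ⟨x, hx⟩ := hne X hX
        exact h hx)⟩
  have h1 : χ.filter ⊆ ω.filter := fun X hX =>
    decide_eq_true (p := ∃ W : σ.E, χ.1 W = true ∧ (W : Set G) ∩ Z ⊆ X)
      ⟨X, hX, Set.inter_subset_left⟩
  have h2 : Z ∈ ω.filter :=
    decide_eq_true (p := ∃ W : σ.E, χ.1 W = true ∧ (W : Set G) ∩ Z ⊆ Z)
      ⟨_, χ.univ, Set.inter_subset_right⟩
  rw [hχ ω h1] at h2
  exact hZ h2

/-- The sets `{η | η X = 1}` with `χ X = 1` form a neighbourhood basis of a maximal character. -/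
theorem exists_nhd_of_mem_maxCharacters {χ : σ.Character} (hχ : χ ∈ σ.maxCharacters)
    (s : Finset σ.E) :
    ∃ X : σ.E, χ.1 X = true ∧ ∀ η : σ.Character, η.1 X = true → ∀ A ∈ s, η.1 A = χ.1 A := by
  classical
  induction s using Finset.induction_on with
  | empty => exact ⟨_, χ.univ, by simp⟩
  | insert A s _ ih =>
    obtain ⟨X, hX, h⟩ := ih
    by_cases hA : χ.1 A = true
    · refine ⟨_, χ.inter_eq_true hX hA, fun η hη B hB => ?_⟩
      rcases Finset.mem_insert.1 hB with rfl | hB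
      · rw [hA]; exact η.mono Set.inter_subset_right hη
      · exact h η (η.mono Set.inter_subset_left hη) B hB
    -- The condition `η A = 0` follows from `η Y = 1` for a `Y` disjoint from `A`.
    · obtain ⟨Y, hY, hYA⟩ := exists_disjoint_of_mem_maxCharacters hχ hA
      refine ⟨_, χ.inter_eq_true hX hY, fun η hη B hB => ?_⟩
      rcases Finset.mem_insert.1 hB with rfl | hB
      · rw [Bool.eq_false_of_not_eq_true hA]
        refine Bool.eq_false_of_not_eq_true fun hηB => ?_
        obtain ⟨x, hx⟩ := η.nonempty (η.inter_eq_true (η.mono Set.inter_subset_right hη) hηB)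
        exact (Set.ext_iff.1 hYA x).1 hx
      · exact h η (η.mono Set.inter_subset_left hη) B hB

theorem _root_.isOpen_setOf_apply_eq {ι : Type*} (i : ι) (b : Bool) :
    IsOpen {f : ι → Bool | f i = b} :=
  (isOpen_discrete ({b} : Set Bool)).preimage (continuous_apply (A := fun _ => Bool) i)

theorem _root_.mem_closure_pi_bool_iff {ι : Type*} {T : Set (ι → Bool)} {f : ι → Bool} :
    f ∈ closure T ↔ ∀ s : Finset ι, ∃ g ∈ T, ∀ i ∈ s, g i = f i := by
  rw [mem_closure_iff]
  constructor
  · intro h s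
    obtain ⟨g, hg, hgT⟩ := h (⋂ i ∈ s, {g | g i = f i})
      (isOpen_biInter_finset fun i _ =>
        isOpen_setOf_apply_eq i (f i))
      (by simp)
    exact ⟨g, hgT, by simpa using hg⟩
  · intro h U hU hf
    obtain ⟨s, u, hu, hsU⟩ := isOpen_pi_iff.1 hU f hf
    obtain ⟨g, hgT, hg⟩ := h s
    exact ⟨g, hsU fun i hi => by rw [hg i hi]; exact (hu i hi).2, hgT⟩

theorem mem_closure_character_iff {T : Set σ.Character} {χ : σ.Character} :
    χ ∈ closure T ↔ ∀ s : Finset σ.E, ∃ η ∈ T, ∀ A ∈ s, η.1 A = χ.1 A := by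
  rw [closure_induced, mem_closure_pi_bool_iff]
  simp

/-- The boundary consists of the characters that are pointwise limits of point characters. -/
theorem mem_boundary_iff {χ : σ.Character} :
    χ ∈ σ.boundary ↔ ∀ s : Finset σ.E, ∃ p : G, ∀ A ∈ s, χ.1 A = true ↔ p ∈ (A : Set G) := by
  rw [boundary, mem_closure_character_iff]
  constructor
  · intro h s
    obtain ⟨η, hη, hs⟩ := h s
    obtain ⟨X, hX, hXs⟩ := exists_nhd_of_mem_maxCharacters hη s
    -- The neighbourhood of `η` given by `X` contains the point character of every point of `X`.
    obtain ⟨p, hp⟩ := η.nonempty hX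
    refine ⟨p, fun A hA => ?_⟩
    rw [← hs A hA, ← hXs (σ.pointCharacter p) (pointCharacter_eq_true.2 hp) A hA,
      pointCharacter_eq_true]
  · intro h s
    obtain ⟨p, hp⟩ := h s
    refine ⟨_, pointCharacter_mem_maxCharacters p, fun A hA => ?_⟩
    rw [Bool.eq_iff_iff, hp A hA, pointCharacter_eq_true]

theorem pointCharacter_mem_boundary (p : G) : σ.pointCharacter p ∈ σ.boundary :=
  subset_closure (pointCharacter_mem_maxCharacters p)

/-- If `p` approximates `χ` on `dom φ` and on the preimages of the given idempotents, then `φ(p)`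
approximates `φ.χ` on those idempotents. -/
theorem act_mem_boundary {φ : G ≃. G} (hφ : φ ∈ σ.I) {χ : σ.Character} (hχ : χ ∈ σ.boundary)
    (h : χ.1 ⟨dom φ, dom_mem_E hφ⟩ = true) : χ.act φ hφ h ∈ σ.boundary := by
  classical
  rw [mem_boundary_iff] at *
  intro s
  obtain ⟨p, hp⟩ := hχ (insert ⟨dom φ, dom_mem_E hφ⟩
    (s.image fun A : σ.E => (⟨preimage φ A, preimage_mem_E hφ A.2⟩ : σ.E)))
  obtain ⟨q, hq⟩ := (hp _ (Finset.mem_insert_self _ _)).1 h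
  refine ⟨q, fun A hA => ?_⟩
  refine (hp _ (Finset.mem_insert_of_mem (Finset.mem_image_of_mem _ hA))).trans ?_
  constructor
  · rintro ⟨y, hy, hpy⟩
    exact Option.mem_unique hpy hq ▸ hy
  · exact fun h => ⟨q, h, hq⟩

/-- A pointwise limit of point characters is a character, and it lies in the boundary. -/
theorem exists_boundary_of_mem_closure {f : σ.E → Bool}
    (hf : f ∈ closure (Set.range fun p => (σ.pointCharacter p).1)) :
    ∃ χ ∈ σ.boundary, χ.1 = f := by
  classical
  have key : ∀ s : Finset σ.E, ∃ p : G, ∀ A ∈ s, f A = true ↔ p ∈ (A : Set G) := by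
    intro s
    obtain ⟨_, ⟨p, rfl⟩, h⟩ := mem_closure_pi_bool_iff.1 hf s
    exact ⟨p, fun A hA => by rw [← h A hA]; exact pointCharacter_eq_true⟩
  refine ⟨⟨f, ⟨⟨_, univ_mem_E⟩, ?_⟩, fun X Y => ?_, fun h => ?_⟩, mem_boundary_iff.2 key, rfl⟩
  · obtain ⟨p, hp⟩ := key {⟨_, univ_mem_E⟩}
    exact (hp _ (Finset.mem_singleton_self _)).2 trivial
  · obtain ⟨p, hp⟩ := key {⟨X ∩ Y, inter_mem_E X.2 Y.2⟩, X, Y}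
    rw [Bool.eq_iff_iff, Bool.and_eq_true, hp _ (by simp), hp X (by simp), hp Y (by simp)]
    rfl
  · obtain ⟨p, hp⟩ := key {⟨_, h⟩}
    exact Bool.eq_false_of_not_eq_true fun h1 => (hp _ (Finset.mem_singleton_self _)).1 h1

/-! ### Minimality and finite covers -/

/-- Every constructible subgroup covers `G` by finitely many images under elements of `I`. -/
def FiniteCovering (σ : AlgebraicAction S G) : Prop :=
  ∀ D : Subgroup G, σ.Constructible D →
    ∃ (n : ℕ) (φ : Fin n → (G ≃. G)), (∀ i, φ i ∈ σ.I) ∧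
      (Set.univ : Set G) = ⋃ i, image (φ i) (D : Set G)

theorem finiteCovering_of_groupoidIsMinimal (hmin : GroupoidIsMinimal σ.UnitSpace) :
    σ.FiniteCovering := by
  intro D hD
  let Y : Set σ.UnitSpace :=
    {χ | ∀ φ : σ.I, χ.1.1 ⟨preimage φ.1 D, preimage_mem_E φ.2 hD.mem_E⟩ = false}
  have hcont : ∀ A : σ.E, Continuous fun χ : σ.UnitSpace => χ.1.1 A := fun A =>
    (continuous_apply A).comp (continuous_induced_dom.comp continuous_subtype_val)
  have hYc : IsClosed Y := by
    have : Y = ⋂ φ : σ.I,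
        {χ | χ.1.1 ⟨preimage φ.1 D, preimage_mem_E φ.2 hD.mem_E⟩ = false} := by
      ext; simp [Y]
    rw [this]
    exact isClosed_iInter fun φ => (isClosed_discrete {false}).preimage (hcont _)
  have hYinv : ∀ x y : σ.UnitSpace, Nonempty (x ⟶ y) → x ∈ Y → y ∈ Y := by
    rintro x y ⟨⟨a⟩⟩ hx φ
    exact (a.apply _).trans ((congrArg x.1.1 (Subtype.ext (preimage_trans _ _ _).symm)).trans
      (hx ⟨a.φ.trans φ.1, .trans a.mem φ.2⟩))
  have hY : Y = ∅ := by
    refine (hmin Y hYc hYinv).resolve_right fun h => ?_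
    -- The point character of `1` is not in `Y`: take `φ = id` and use `1 ∈ D`.
    have h1 : (⟨σ.pointCharacter 1, pointCharacter_mem_boundary 1⟩ : σ.UnitSpace) ∈ Y :=
      h ▸ Set.mem_univ _
    have h2 := h1 ⟨_, refl_mem_I⟩
    rw [pointCharacter_eq_true.2] at h2
    · cases h2
    · exact ⟨1, D.one_mem, rfl⟩
  -- The boundary is handled as a closed subset of the compact product `{0,1}^ℰ`, covered by the
  -- open conditions `f (φ⁻¹(D)) = 1`.
  obtain ⟨t, ht⟩ := (isClosed_closure (s := Set.range fun p =>
      (σ.pointCharacter p).1)).isCompact.elim_finite_subcover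
    (fun φ : σ.I => {f : σ.E → Bool | f ⟨preimage φ.1 D, preimage_mem_E φ.2 hD.mem_E⟩ = true})
    (fun φ => isOpen_setOf_apply_eq _ true) (by
      intro f hf
      obtain ⟨χ, hχ, rfl⟩ := exists_boundary_of_mem_closure hf
      by_contra hcon
      simp only [Set.mem_iUnion, not_exists] at hcon
      have : (⟨χ, hχ⟩ : σ.UnitSpace) ∈ Y := fun φ => Bool.eq_false_of_not_eq_true (hcon φ)
      rw [hY] at this
      exact this)
  refine ⟨t.card, fun i => (t.equivFin.symm i).1.1.symm, fun i => .symm (t.equivFin.symm i).1.2, ?_⟩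
  refine (Set.eq_univ_of_forall fun p => ?_).symm
  have hp := ht (subset_closure ⟨p, rfl⟩)
  simp only [Set.mem_iUnion] at hp
  obtain ⟨φ, hφt, hφ⟩ := hp
  rw [Set.mem_iUnion]
  refine ⟨t.equivFin ⟨φ, hφt⟩, ?_⟩
  simp only [Equiv.symm_apply_apply, image_eq_preimage_symm]
  exact pointCharacter_eq_true.1 hφ

theorem groupoidIsMinimal_of_finiteCovering (hcov : σ.FiniteCovering) :
    GroupoidIsMinimal σ.UnitSpace := by
  classical
  intro Y hYc hYinv
  rcases Y.eq_empty_or_nonempty with h | ⟨χ, hχY⟩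
  · exact Or.inl h
  refine Or.inr (Set.eq_univ_of_forall fun ω => ?_)
  rw [← hYc.closure_eq, closure_subtype, mem_closure_character_iff]
  intro s
  obtain ⟨p, hp⟩ := mem_boundary_iff.1 ω.2 s
  -- It suffices to find in the orbit of `χ` a character that is `1` at `X = pC`: on `s` it agrees
  -- with the point character of `p`, hence with `ω`.
  obtain ⟨X, hX, hXs⟩ := exists_nhd_of_mem_maxCharacters (pointCharacter_mem_maxCharacters p) s
  obtain ⟨C, hC, hXC⟩ := exists_coset_of_mem_E X.2 (pointCharacter_eq_true.1 hX)
  obtain ⟨n, φ, hφ, hcover⟩ := hcov C hC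
  have hE : ∀ i, image (φ i) (C : Set G) ∈ σ.E := fun i =>
    image_eq_preimage_symm (φ i) _ ▸ preimage_mem_E (.symm (hφ i)) hC.mem_E
  -- As a limit of point characters, `χ` must be `1` on some member of a finite cover of `G`.
  obtain ⟨q, hq⟩ := mem_boundary_iff.1 χ.2 (Finset.univ.image fun i => ⟨_, hE i⟩)
  obtain ⟨i, hi⟩ := Set.mem_iUnion.1 (hcover ▸ Set.mem_univ q)
  have hχi := (hq ⟨_, hE i⟩ (Finset.mem_image_of_mem _ (Finset.mem_univ i))).2 hi
  -- This sends `φ i (C)` back to `C` and then into `pC = X`.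
  let ψ : G ≃. G := (φ i).symm.trans (translation p)
  have hψ : ψ ∈ σ.I := .trans (.symm (hφ i)) (translation_mem_I p)
  have hsub : image (φ i) (C : Set G) ⊆ preimage ψ X := by
    rintro y ⟨x, hx, hxy⟩
    refine ⟨p * x, (hXC _).2 (by simpa using hx), (PEquiv.mem_trans _ _ _ _).2
      ⟨x, (PEquiv.mem_iff_mem _).2 hxy, mem_translation.2 rfl⟩⟩
  have hdom : χ.1.1 ⟨dom ψ, dom_mem_E hψ⟩ = true := by
    refine χ.1.mono (fun y hy => ?_) hχi
    obtain ⟨z, -, hz⟩ := hsub hy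
    exact ⟨z, hz⟩
  have hη := act_mem_boundary hψ χ.2 hdom
  have hηX : (χ.1.act ψ hψ hdom).1 X = true :=
    χ.1.mono (Y := ⟨_, preimage_mem_E hψ X.2⟩) hsub hχi
  refine ⟨_, ⟨⟨_, hη⟩, hYinv χ _ ⟨?_⟩ hχY, rfl⟩, fun A hA => ?_⟩
  · exact Quotient.mk (germSetoid _ _) ⟨ψ, hψ, hdom, rfl⟩
  · rw [hXs _ hηX A hA, Bool.eq_iff_iff, pointCharacter_eq_true, hp A hA]

/-! ### Finite covers and subgroups of finite index -/

/-- Every constructible subgroup contains a constructible subgroup that some element of `I^e` maps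
onto a subgroup of finite index. -/
def FiniteIndexImages (σ : AlgebraicAction S G) : Prop :=
  ∀ D : Subgroup G, σ.Constructible D →
    ∃ (φ : G ≃. G) (hφ : φ ∈ σ.Ie) (D' : Subgroup G), σ.Constructible D' ∧
      (D' : Set G) ⊆ (D : Set G) ∩ dom φ ∧ (imageSubgroup φ hφ D').FiniteIndex

theorem mem_imageSubgroup {φ : G ≃. G} {hφ : φ ∈ σ.Ie} {D : Subgroup G} {y : G} :
    y ∈ imageSubgroup φ hφ D ↔ ∃ x ∈ D, y ∈ φ x := Iff.rfl

open Pointwise in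
theorem finiteIndexImages_of_finiteCovering (h : σ.FiniteCovering) : σ.FiniteIndexImages := by
  classical
  intro D hD
  obtain ⟨n, φ, hφ, hcover⟩ := h D hD
  have key : ∀ i, ∃ (ψ : G ≃. G) (hψ : ψ ∈ σ.Ie) (y : G),
      image (φ i) (D : Set G) ⊆ y • (imageSubgroup ψ hψ D : Set G) := by
    intro i
    rcases (image (φ i) (D : Set G)).eq_empty_or_nonempty with h0 | ⟨y, x, hx, hxy⟩
    · exact ⟨_, refl_mem_Ie, 1, h0 ▸ Set.empty_subset _⟩
    · obtain ⟨ψ, hψ, h⟩ := exists_mem_Ie_of_mem_I (hφ i) hxy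
      refine ⟨ψ, hψ, y, ?_⟩
      rintro b ⟨a, ha, hab⟩
      rw [mem_leftCoset_iff]
      exact ⟨x⁻¹ * a, D.mul_mem (D.inv_mem hx) ha, (h a b).1 hab⟩
  choose ψ hψ y hsub using key
  -- B. H. Neumann's lemma.
  obtain ⟨i, -, hi⟩ := Subgroup.exists_finiteIndex_of_leftCoset_cover
    (H := fun i => imageSubgroup (ψ i) (hψ i) D) (g := y) (s := Finset.univ) (by
      refine Set.eq_univ_of_forall fun p => ?_
      obtain ⟨i, hi⟩ := Set.mem_iUnion.1 (hcover ▸ Set.mem_univ p)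
      exact Set.mem_biUnion (Finset.mem_coe.2 (Finset.mem_univ i)) (hsub i hi))
  -- The witness is `D ∩ dom (ψ i)`, which has the same image under `ψ i` as `D`.
  refine ⟨ψ i, hψ i, D ⊓ imageSubgroup (ψ i).symm (.symm (hψ i)) ⊤,
    constructible_inf hD (constructible_image _ .top), ?_, ?_⟩
  · rintro x ⟨hx, z, -, hz⟩
    exact ⟨hx, z, (PEquiv.mem_iff_mem _).1 hz⟩
  · convert hi using 1
    ext z
    simp only [mem_imageSubgroup, Subgroup.mem_inf]
    constructor
    · rintro ⟨x, hx, hxz⟩; exact ⟨x, hx.1, hxz⟩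
    · rintro ⟨x, hx, hxz⟩
      exact ⟨x, ⟨hx, z, trivial, (PEquiv.mem_iff_mem _).2 hxz⟩, hxz⟩

theorem finiteCovering_of_finiteIndexImages (h : σ.FiniteIndexImages) : σ.FiniteCovering := by
  intro D hD
  obtain ⟨φ, hφ, D', hD', hsub, hfin⟩ := h D hD
  have : Finite (G ⧸ imageSubgroup φ hφ D') := Subgroup.finite_quotient_of_finiteIndex
  obtain ⟨n, ⟨e⟩⟩ := Finite.exists_equiv_fin (G ⧸ imageSubgroup φ hφ D')
  -- Compose `φ` with translations by representatives of the finitely many left cosets of `φ(D')`.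
  refine ⟨n, fun i => φ.trans (translation (e.symm i).out),
    fun i => .trans (Ie_subset_I hφ) (translation_mem_I _), ?_⟩
  refine (Set.eq_univ_of_forall fun p => Set.mem_iUnion.2 ⟨e (QuotientGroup.mk p), ?_⟩).symm
  simp only [Equiv.symm_apply_apply]
  obtain ⟨x, hx, hxy⟩ := QuotientGroup.eq.1 (QuotientGroup.out_eq' (QuotientGroup.mk (s := imageSubgroup φ hφ D') p))
  exact ⟨x, (hsub hx).1, (PEquiv.mem_trans _ _ _ _).2
    ⟨_, hxy, mem_translation.2 (mul_inv_cancel_left _ _).symm⟩⟩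

/-! ### Finitely hereditary filters -/

theorem imageSubgroup_mono {φ : G ≃. G} (hφ : φ ∈ σ.Ie) {A B : Subgroup G} (h : A ≤ B) :
    imageSubgroup φ hφ A ≤ imageSubgroup φ hφ B := by
  rintro y ⟨x, hx, hxy⟩
  exact ⟨x, h hx, hxy⟩

theorem imageSubgroup_symm_imageSubgroup_le {φ : G ≃. G} (hφ : φ ∈ σ.Ie)
    (hφ' : φ.symm ∈ σ.Ie) (B : Subgroup G) :
    imageSubgroup φ.symm hφ' (imageSubgroup φ hφ B) ≤ B := by
  rintro x ⟨y, ⟨z, hz, hzy⟩, hyx⟩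
  rw [PEquiv.mem_iff_mem] at hyx
  exact φ.inj hzy hyx ▸ hz

theorem imageSubgroup_imageSubgroup_symm_le {φ : G ≃. G} (hφ : φ ∈ σ.Ie)
    (hφ' : φ.symm ∈ σ.Ie) (B : Subgroup G) :
    imageSubgroup φ hφ (imageSubgroup φ.symm hφ' B) ≤ B := by
  rintro x ⟨y, ⟨z, hz, hzy⟩, hyx⟩
  rw [PEquiv.mem_iff_mem] at hzy
  exact Option.mem_unique hzy hyx ▸ hz

theorem le_imageSubgroup_symm_imageSubgroup {φ : G ≃. G} (hφ : φ ∈ σ.Ie)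
    (hφ' : φ.symm ∈ σ.Ie) {B : Subgroup G} (hB : (B : Set G) ⊆ dom φ) :
    B ≤ imageSubgroup φ.symm hφ' (imageSubgroup φ hφ B) := by
  intro x hx
  obtain ⟨y, hy⟩ := hB hx
  exact ⟨y, ⟨x, hx, hy⟩, (PEquiv.mem_iff_mem _).2 hy⟩

/-- An element of `I^e` restricts to a homomorphism on every subgroup of its domain. -/
noncomputable def homOfMemIe {φ : G ≃. G} (hφ : φ ∈ σ.Ie) {B : Subgroup G}
    (hB : (B : Set G) ⊆ dom φ) : B →* G :=
  have hspec : ∀ x : B, (hB x.2).choose ∈ φ x := fun x => (hB x.2).choose_spec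
  MonoidHom.mk' (fun x => (hB x.2).choose) fun x y =>
    Option.mem_unique (hspec (x * y)) (Ie_mul hφ (hspec x) (hspec y))

theorem homOfMemIe_spec {φ : G ≃. G} (hφ : φ ∈ σ.Ie) {B : Subgroup G}
    (hB : (B : Set G) ⊆ dom φ) (x : B) : homOfMemIe hφ hB x ∈ φ x :=
  (hB x.2).choose_spec

/-- If `φ (B) ≤ A`, then the preimage under `φ|_B` of a subgroup of finite index in `A` has finite
index in `B`. -/
theorem isFiniteRelIndex_preimage {φ : G ≃. G} (hφ : φ ∈ σ.Ie) (hφ' : φ.symm ∈ σ.Ie)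
    {A A' B : Subgroup G} (hB : (B : Set G) ⊆ dom φ) (hBA : imageSubgroup φ hφ B ≤ A)
    (hfin : A'.IsFiniteRelIndex A) :
    (B ⊓ imageSubgroup φ.symm hφ' A').IsFiniteRelIndex B := by
  let f := homOfMemIe hφ hB
  have hf := homOfMemIe_spec hφ hB
  have hr : f.range ≤ A := by
    rintro _ ⟨x, rfl⟩
    exact hBA ⟨x, x.2, hf x⟩
  -- The index of `f⁻¹(A')` in `B` is that of `A' ∩ f(B)` in `f(B)`, and it is finite since `f(B) ≤
  -- A`.
  have h1 : A'.relIndex f.range ≠ 0 :=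
    fun h0 => hfin.relIndex_ne_zero (by
      exact Subgroup.relIndex_eq_zero_of_le_right hr h0)
  have h2 : (B ⊓ imageSubgroup φ.symm hφ' A').subgroupOf B = A'.comap f := by
    ext x
    simp only [Subgroup.mem_subgroupOf, Subgroup.mem_inf, mem_imageSubgroup, Subgroup.mem_comap,
      PEquiv.mem_iff_mem]
    constructor
    · rintro ⟨-, y, hy, hxy⟩
      exact Option.mem_unique hxy (hf x) ▸ hy
    · exact fun hx => ⟨x.2, _, hx, hf x⟩
  refine ⟨?_⟩
  rw [Subgroup.relIndex, h2, Subgroup.index_comap]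
  exact h1

/-- The filter `φ.F` is already generated by the sets `φ (D)` as a filter. -/
theorem mem_act_iff {φ : G ≃. G} (hφ : φ ∈ σ.Ie) {F : Set (Subgroup G)} (hF : F ∈ σ.FHFilters)
    (hdef : ActDefined φ F) {A : Subgroup G} :
    A ∈ act φ hφ F ↔ σ.Constructible A ∧
      ∃ B ∈ F, (B : Set G) ⊆ dom φ ∧ imageSubgroup φ hφ B ≤ A := by
  obtain ⟨C, hCF, hC⟩ := hdef
  have hφ' : φ.symm ∈ σ.Ie := .symm hφ
  constructor
  · intro hA
    refine hA {A | σ.Constructible A ∧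
      ∃ B ∈ F, (B : Set G) ⊆ dom φ ∧ imageSubgroup φ hφ B ≤ A} ⟨⟨?_, ?_, ?_, ?_, ?_⟩, ?_⟩
    · exact fun _ h => h.1
    · exact ⟨.top, C, hCF, hC, le_top⟩
    · rintro A A' ⟨-, B, hBF, hB, hBA⟩ hA' hAA'
      exact ⟨hA', B, hBF, hB, hBA.trans hAA'⟩
    · rintro A A' ⟨hA, B, hBF, hB, hBA⟩ ⟨hA', B', hBF', hB', hBA'⟩
      exact ⟨constructible_inf hA hA', B ⊓ B', hF.2.2.2.1 _ _ hBF hBF', fun x hx => hB hx.1,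
        le_inf ((imageSubgroup_mono hφ inf_le_left).trans hBA)
          ((imageSubgroup_mono hφ inf_le_right).trans hBA')⟩
    · rintro A A' ⟨hA, B, hBF, hB, hBA⟩ hA' hAA' hfin
      -- Finite heredity passes from `F` to its image: the part of `B` mapped into `A'` has finite
      -- index in `B`, so it lies in `F`.
      refine ⟨hA', B ⊓ imageSubgroup φ.symm hφ' A',
        hF.2.2.2.2 B _ hBF (constructible_inf (hF.1 B hBF) (constructible_image hφ' hA'))
          inf_le_left (isFiniteRelIndex_preimage hφ hφ' hB hBA hfin), fun x hx => hB hx.1, ?_⟩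
      exact (imageSubgroup_mono hφ inf_le_right).trans
        (imageSubgroup_imageSubgroup_symm_le hφ hφ' A')
    · intro D hDF hD
      exact ⟨constructible_image hφ (hF.1 D hDF), D, hDF, hD, le_rfl⟩
  · rintro ⟨hA, B, hBF, hB, hBA⟩ H hH
    exact hH.1.2.2.1 _ _ (hH.2 B hBF hB) hA hBA

theorem act_mem_FHFilters {φ : G ≃. G} (hφ : φ ∈ σ.Ie) {F : Set (Subgroup G)}
    (hF : F ∈ σ.FHFilters) (hdef : ActDefined φ F) : act φ hφ F ∈ σ.FHFilters := by
  obtain ⟨C, hCF, hC⟩ := hdef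
  exact (act_isLeast φ hφ hF hCF hC).1.1

/-! ### Minimality of the space of filters -/

/-- There are no proper non-empty invariant closed sets of filters. -/
def FiltersMinimal (σ : AlgebraicAction S G) : Prop :=
  ∀ 𝔉 : Set (Set (Subgroup G)), 𝔉 ⊆ σ.FHFilters → 𝔉.Nonempty →
    σ.FilterInvariant 𝔉 → σ.SubsetClosed 𝔉 → 𝔉 = σ.FHFilters

/-- Every filter `F` contains all constructible subgroups of finite index, in particular `φ(D')`.
Applying `φ⁻¹` puts `D ⊇ D'` into a translate of `F`, so the union of an invariant family is all of
`𝒞`. -/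
theorem filtersMinimal_of_finiteIndexImages (h : σ.FiniteIndexImages) : σ.FiltersMinimal := by
  rintro 𝔉 hsub ⟨F, hF𝔉⟩ hinv hclosed
  refine Set.Subset.antisymm hsub fun H hH => hclosed H hH fun D hDH => ?_
  have hD := hH.1 D hDH
  have hF := hsub hF𝔉
  obtain ⟨φ, hφ, D', hD', hD'D, hfin⟩ := h D hD
  have hφ' : φ.symm ∈ σ.Ie := .symm hφ
  have hmem : imageSubgroup φ hφ D' ∈ F :=
    hF.2.2.2.2 ⊤ _ hF.2.1 (constructible_image hφ hD') le_top
      ⟨by rw [Subgroup.relIndex_top_right]; exact hfin.index_ne_zero⟩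
  have hdom : ((imageSubgroup φ hφ D' : Subgroup G) : Set G) ⊆ dom φ.symm := by
    rintro y ⟨x, -, hxy⟩
    exact ⟨x, (PEquiv.mem_iff_mem _).2 hxy⟩
  have hdef : ActDefined φ.symm F := ⟨_, hmem, hdom⟩
  refine ⟨_, hinv F hF𝔉 φ.symm hφ' hdef, (mem_act_iff hφ' hF hdef).2
    ⟨hD, _, hmem, hdom, ?_⟩⟩
  exact (imageSubgroup_symm_imageSubgroup_le hφ hφ' D').trans fun x hx => (hD'D hx).1

/-- This is the least finitely hereditary filter, as each one contains `⊤`. -/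
theorem finiteIndexConstructible_mem_FHFilters :
    {C : Subgroup G | σ.Constructible C ∧ C.FiniteIndex} ∈ σ.FHFilters := by
  refine ⟨fun _ h => h.1, ⟨.top, inferInstance⟩, ?_, ?_, ?_⟩
  · rintro C D ⟨-, hC⟩ hD hCD
    exact ⟨hD, Subgroup.finiteIndex_of_le hCD⟩
  · rintro C D ⟨hC, hCf⟩ ⟨hD, hDf⟩
    exact ⟨constructible_inf hC hD, inferInstance⟩
  · rintro C D ⟨hC, hCf⟩ hD hDC hfin
    refine ⟨hD, ⟨?_⟩⟩
    rw [← Subgroup.relIndex_mul_index hDC]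
    exact mul_ne_zero hfin.relIndex_ne_zero hCf.index_ne_zero

theorem finiteIndexImages_of_filtersMinimal (h : σ.FiltersMinimal) : σ.FiniteIndexImages := by
  intro D hD
  -- The union of the translates under `I^e` of the least filter, the one of finite-index subgroups.
  let U : Set (Subgroup G) := {A | ∃ (φ : G ≃. G) (hφ : φ ∈ σ.Ie) (B : Subgroup G),
    σ.Constructible B ∧ B.FiniteIndex ∧ (B : Set G) ⊆ dom φ ∧ imageSubgroup φ hφ B ≤ A}
  have hU := h {F | F ∈ σ.FHFilters ∧ F ⊆ U} (fun F hF => hF.1) ?_ ?_ ?_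
  · have h1 : {C | σ.Constructible C} ⊆ U :=
      (hU.symm ▸ constructible_mem_FHFilters :
        {C | σ.Constructible C} ∈ {F | F ∈ σ.FHFilters ∧ F ⊆ U}).2
    obtain ⟨φ, hφ, B, hB, hBf, hBφ, hBD⟩ := h1 hD
    have hφ' : φ.symm ∈ σ.Ie := .symm hφ
    -- With `D' = φ(B) ≤ D`, the map `φ⁻¹` carries `D'` back onto `B`, of finite index.
    refine ⟨φ.symm, hφ', imageSubgroup φ hφ B, constructible_image hφ hB, fun y hy => ⟨hBD hy, ?_⟩,
      Subgroup.finiteIndex_of_le (le_imageSubgroup_symm_imageSubgroup hφ hφ' hBφ)⟩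
    obtain ⟨x, -, hxy⟩ := hy
    exact ⟨x, (PEquiv.mem_iff_mem _).2 hxy⟩
  · refine ⟨_, finiteIndexConstructible_mem_FHFilters, ?_⟩
    rintro C ⟨hC, hCf⟩
    refine ⟨_, refl_mem_Ie, C, hC, hCf, fun x _ => ⟨x, rfl⟩, ?_⟩
    rintro y ⟨x, hx, hxy⟩
    obtain rfl : x = y := Option.some_inj.1 hxy
    exact hx
  · rintro F ⟨hF, hFU⟩ ψ hψ hdef
    refine ⟨act_mem_FHFilters hψ hF hdef, fun A hA => ?_⟩
    obtain ⟨-, B, hBF, hBψ, hBA⟩ := (mem_act_iff hψ hF hdef).1 hA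
    obtain ⟨φ, hφ, B₀, hB₀, hB₀f, hB₀φ, hB₀B⟩ := hFU hBF
    refine ⟨φ.trans ψ, .trans hφ hψ, B₀, hB₀, hB₀f, fun x hx => ?_, ?_⟩
    · obtain ⟨y, hy⟩ := hB₀φ hx
      obtain ⟨z, hz⟩ := hBψ (hB₀B ⟨x, hx, hy⟩)
      exact ⟨z, (PEquiv.mem_trans _ _ _ _).2 ⟨y, hy, hz⟩⟩
    · rintro z ⟨x, hx, hxz⟩
      obtain ⟨y, hy, hz⟩ := (PEquiv.mem_trans _ _ _ _).1 hxz
      exact hBA ⟨y, hB₀B ⟨x, hx, hy⟩, hz⟩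
  · rintro F hF hFsub
    refine ⟨hF, fun A hA => ?_⟩
    obtain ⟨H, hH, hAH⟩ := hFsub hA
    exact hH.2 hAH

/-! ### Assembling the equivalences -/

theorem groupoidIsMinimal_iff_finiteCovering :
    GroupoidIsMinimal σ.UnitSpace ↔ σ.FiniteCovering :=
  ⟨finiteCovering_of_groupoidIsMinimal, groupoidIsMinimal_of_finiteCovering⟩

theorem groupoidIsMinimal_iff_finiteIndexImages :
    GroupoidIsMinimal σ.UnitSpace ↔ σ.FiniteIndexImages :=
  groupoidIsMinimal_iff_finiteCovering.trans
    ⟨finiteIndexImages_of_finiteCovering, finiteCovering_of_finiteIndexImages⟩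

theorem finiteIndexImages_iff_forall_pair :
    σ.FiniteIndexImages ↔
      ∀ C D : Subgroup G, σ.Constructible C → σ.Constructible D →
        ∃ (φ : G ≃. G) (hφ : φ ∈ σ.Ie) (D' : Subgroup G), σ.Constructible D' ∧
          (D' : Set G) ⊆ (D : Set G) ∩ dom φ ∧
          imageSubgroup φ hφ D' ≤ C ∧ (imageSubgroup φ hφ D').IsFiniteRelIndex C := by
  constructor
  · intro h C D hC hD
    obtain ⟨φ, hφ, D', hD', hsub, hfin⟩ := h D hD
    have hφ' : φ.symm ∈ σ.Ie := .symm hφ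
    -- Shrinking `D'` to `D' ∩ φ⁻¹(C)` cuts the image down to `φ(D') ∩ C`, which has finite index in
    -- `C`.
    have heq : imageSubgroup φ hφ (D' ⊓ imageSubgroup φ.symm hφ' C) =
        imageSubgroup φ hφ D' ⊓ C := by
      ext y
      simp only [mem_imageSubgroup, Subgroup.mem_inf, PEquiv.mem_iff_mem]
      constructor
      · rintro ⟨x, ⟨hx, z, hz, hxz⟩, hxy⟩
        exact ⟨⟨x, hx, hxy⟩, Option.mem_unique hxz hxy ▸ hz⟩
      · rintro ⟨⟨x, hx, hxy⟩, hy⟩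
        exact ⟨x, ⟨hx, y, hy, hxy⟩, hxy⟩
    refine ⟨φ, hφ, _, constructible_inf hD' (constructible_image hφ' hC),
      fun x hx => hsub hx.1, heq ▸ inf_le_right, ⟨?_⟩⟩
    rw [heq, Subgroup.inf_relIndex_right]
    exact fun h0 => hfin.index_ne_zero (by
      rw [← Subgroup.relIndex_top_right]
      exact Subgroup.relIndex_eq_zero_of_le_right le_top h0)
  · intro h D hD
    obtain ⟨φ, hφ, D', hD', hsub, -, hfin⟩ := h ⊤ D .top hD
    exact ⟨φ, hφ, D', hD', hsub, ⟨by
      rw [← Subgroup.relIndex_top_right]; exact hfin.relIndex_ne_zero⟩⟩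

theorem finiteCovering_iff_forall_pair :
    σ.FiniteCovering ↔
      ∀ C D : Subgroup G, σ.Constructible C → σ.Constructible D →
        ∃ (n : ℕ) (φ : Fin n → (G ≃. G)), (∀ i, φ i ∈ σ.I) ∧
          (C : Set G) ⊆ ⋃ i, image (φ i) (D : Set G) := by
  constructor
  · intro h C D _ hD
    obtain ⟨n, φ, hφ, hcover⟩ := h D hD
    exact ⟨n, φ, hφ, hcover ▸ Set.subset_univ _⟩
  · intro h D hD
    obtain ⟨n, φ, hφ, hcover⟩ := h ⊤ D .top hD
    exact ⟨n, φ, hφ, (Set.univ_subset_iff.1 hcover).symm⟩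

end AlgebraicAction

theorem mainTheorem2 {S : Type*} {G : Type*} [Monoid S] [Group G]
    (σ : AlgebraicAction S G) (hσ : σ.NonAutomorphic) :
    (GroupoidIsMinimal σ.UnitSpace ↔
      ∀ C D : Subgroup G, σ.Constructible C → σ.Constructible D →
        ∃ (n : ℕ) (φ : Fin n → (G ≃. G)), (∀ i, φ i ∈ σ.I) ∧
          (C : Set G) ⊆ ⋃ i, PartialBij.image (φ i) (D : Set G)) ∧
    (GroupoidIsMinimal σ.UnitSpace ↔
      ∀ D : Subgroup G, σ.Constructible D →
        ∃ (n : ℕ) (φ : Fin n → (G ≃. G)), (∀ i, φ i ∈ σ.I) ∧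
          (Set.univ : Set G) = ⋃ i, PartialBij.image (φ i) (D : Set G)) ∧
    (GroupoidIsMinimal σ.UnitSpace ↔
      ∀ C D : Subgroup G, σ.Constructible C → σ.Constructible D →
        ∃ (φ : G ≃. G) (hφ : φ ∈ σ.Ie) (D' : Subgroup G), σ.Constructible D' ∧
          (D' : Set G) ⊆ (D : Set G) ∩ PartialBij.dom φ ∧
          AlgebraicAction.imageSubgroup φ hφ D' ≤ C ∧
          (AlgebraicAction.imageSubgroup φ hφ D').IsFiniteRelIndex C) ∧
    (GroupoidIsMinimal σ.UnitSpace ↔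
      ∀ D : Subgroup G, σ.Constructible D →
        ∃ (φ : G ≃. G) (hφ : φ ∈ σ.Ie) (D' : Subgroup G), σ.Constructible D' ∧
          (D' : Set G) ⊆ (D : Set G) ∩ PartialBij.dom φ ∧
          (AlgebraicAction.imageSubgroup φ hφ D').FiniteIndex) ∧
    (GroupoidIsMinimal σ.UnitSpace ↔
      ∀ 𝔉 : Set (Set (Subgroup G)), 𝔉 ⊆ σ.FHFilters → 𝔉.Nonempty →
        σ.FilterInvariant 𝔉 → σ.SubsetClosed 𝔉 → 𝔉 = σ.FHFilters) := by
  exact ⟨AlgebraicAction.groupoidIsMinimal_iff_finiteCovering.trans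
      AlgebraicAction.finiteCovering_iff_forall_pair,
    AlgebraicAction.groupoidIsMinimal_iff_finiteCovering,
    AlgebraicAction.groupoidIsMinimal_iff_finiteIndexImages.trans
      AlgebraicAction.finiteIndexImages_iff_forall_pair,
    AlgebraicAction.groupoidIsMinimal_iff_finiteIndexImages,
    AlgebraicAction.groupoidIsMinimal_iff_finiteIndexImages.trans
      ⟨AlgebraicAction.filtersMinimal_of_finiteIndexImages,
        AlgebraicAction.finiteIndexImages_of_filtersMinimal⟩⟩
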